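/- Let $\mathcal F^2$ be the Fock space of entire functions $f$ with $\int_{\mathbb C}|f(z)|^2e^{-|z|^2}\,dV(z)<\infty$, with inner product $\langle f,g\rangle=\frac1\pi\int_{\mathbb C}f(z)\overline{g(z)}e^{-|z|^2}\,dV(z)$. Let $a,b,c\in\mathbb C$ satisfy $|a|=1$, $\bar ab+\bar b=0$, $|c|^2e^{|b|^2}=1$, and let $\mathcal C_{a,b,c}f(z)=ce^{bz}\overline{f(\overline{az+b})}$ for $f\in\mathcal F^2$. Let $m\ge 0$ be an integer and let $\psi,\varphi,\phi$ be entire functions such that $\psi$ has no zeros, $\phi\not\equiv0$, and, if $m\ge1$, $\varphi$ is not constant. Let $\mathbf S_{\max}$ be the maximal multi-valued weighted composition operator, that is, the multi-valued linear operator with graph $$G(\mathbf S_{\max})=\{(f,g)\in\mathcal F^2\times\mathcal F^2:\ \psi(z)f(\varphi(z))=\phi(z)g^{(m)}(z)\ \text{for all } z\in\mathbb C\},$$ and let $\mathbf S^*_{\max,\mathcal C_{a,b,c}}$ be its $\mathcal C_{a,b,c}$-adjoint, with graph $$G(\mathbf S^*_{\max,\mathcal C_{a,b,c}})=\{(u,v)\in\mathcal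 F^2\times\mathcal F^2:\ \langle g,\mathcal C_{a,b,c}u\rangle=\langle f,\mathcal C_{a,b,c}v\rangle\ \text{for all }(f,g)\in G(\mathbf S_{\max})\}.$$ Then the following assertions are equivalent. 1. $\mathbf S_{\max}$ is $\mathcal C_{a,b,c}$-selfadjoint, i.e. $G(\mathbf S^*_{\max,\mathcal C_{a,b,c}})=G(\mathbf S_{\max})$. 2. $G(\mathbf S^*_{\max,\mathcal C_{a,b,c}})\subset G(\mathbf S_{\max})$. 3. There is an equivalent triple of symbols $(\psi_1,\varphi,\phi_1)$ (entire functions $\psi_1,\phi_1$, with $\psi_1$ zero-free and $\phi_1/\psi_1=\phi/\psi$) and there are constants $A,B,C,D\in\mathbb C$ with $C\ne0$ and $D=b+aB-bA$ such that $$\varphi(y)=Ay+B,\qquad Ce^{Dy}\phi_1(y)=\psi_1(y)\,[a(Ay+B)+b]^m\qquad\text{for all }y\in\mathbb C.$$ -/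

import Mathlib

open MeasureTheory

noncomputable section

/-! ### The Fock space -/

/-- The Fock space as a set of functions: entire functions `f` for which
`|f(z)|² exp(-|z|²)` is integrable with respect to Lebesgue measure on `ℂ`. -/
def fockSubmodule : Submodule ℂ (ℂ → ℂ) where
  carrier := {f | Differentiable ℂ f ∧
    Integrable (fun z : ℂ => ‖f z‖ ^ 2 * Real.exp (-‖z‖ ^ 2))}
  zero_mem' := by
    refine ⟨differentiable_const 0, ?_⟩
    simp
  add_mem' := by
    rintro f g ⟨hf, hfi⟩ ⟨hg, hgi⟩
    refine ⟨hf.add hg, ?_⟩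
    refine ((hfi.add hgi).const_mul 2).mono' ?_ ?_
    · have h1 := (hf.add hg).continuous
      exact Continuous.aestronglyMeasurable (by fun_prop)
    · filter_upwards with z
      have he := (Real.exp_pos (-‖z‖ ^ 2)).le
      have hn : 0 ≤ ‖f z + g z‖ ^ 2 * Real.exp (-‖z‖ ^ 2) := by positivity
      have h2 : ‖f z + g z‖ ^ 2 ≤ 2 * (‖f z‖ ^ 2 + ‖g z‖ ^ 2) := by
        have h3 := norm_add_le (f z) (g z)
        nlinarith [sq_nonneg (‖f z‖ - ‖g z‖), norm_nonneg (f z + g z)]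
      have h4 := mul_le_mul_of_nonneg_right h2 he
      simp only [Pi.add_apply] at *
      rw [Real.norm_of_nonneg hn]
      linarith
  smul_mem' := by
    rintro k f ⟨hf, hfi⟩
    refine ⟨hf.const_smul k, ?_⟩
    refine (hfi.const_mul (‖k‖ ^ 2)).congr ?_
    filter_upwards with z
    simp only [Pi.smul_apply, smul_eq_mul, norm_mul]
    ring

/-- The Fock space `F²`. -/
def FockSpace : Type := ↥fockSubmodule

instance : AddCommGroup FockSpace := inferInstanceAs (AddCommGroup ↥fockSubmodule)

instance : Module ℂ FockSpace := inferInstanceAs (Module ℂ ↥fockSubmodule)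

instance : CoeFun FockSpace (fun _ => ℂ → ℂ) := ⟨fun f => f.1⟩

namespace FockSpace

@[simp] theorem add_apply (f g : FockSpace) (z : ℂ) : (f + g) z = f z + g z := rfl

@[simp] theorem smul_apply (k : ℂ) (f : FockSpace) (z : ℂ) : (k • f) z = k * f z := rfl

@[simp] theorem zero_apply (z : ℂ) : (0 : FockSpace) z = 0 := rfl

@[ext] theorem ext {f g : FockSpace} (h : ∀ z, f z = g z) : f = g :=
  Subtype.ext (funext h)

theorem differentiable (f : FockSpace) : Differentiable ℂ (f : ℂ → ℂ) := f.2.1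

theorem integrable (f : FockSpace) :
    Integrable (fun z : ℂ => ‖f z‖ ^ 2 * Real.exp (-‖z‖ ^ 2)) := f.2.2

theorem integrable_mul (f g : FockSpace) :
    Integrable (fun z : ℂ => star (f z) * g z * (Real.exp (-‖z‖ ^ 2) : ℂ)) := by
  refine (f.integrable.add g.integrable).mono' ?_ ?_
  · have h1 := f.differentiable.continuous
    have h2 := g.differentiable.continuous
    exact Continuous.aestronglyMeasurable (by fun_prop)
  · filter_upwards with z
    have he := (Real.exp_pos (-‖z‖ ^ 2)).le
    have h2 : ‖f z‖ * ‖g z‖ ≤ ‖f z‖ ^ 2 + ‖g z‖ ^ 2 := by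
      nlinarith [sq_nonneg (‖f z‖ - ‖g z‖), sq_nonneg (‖f z‖), sq_nonneg (‖g z‖)]
    have h4 := mul_le_mul_of_nonneg_right h2 he
    simp only [norm_mul, norm_star, Complex.norm_real, Real.norm_eq_abs, Real.abs_exp,
      Pi.add_apply]
    linarith

/-- The inner product of the Fock space; following Mathlib's convention it is conjugate linear
in its first argument, so the mathematicians' `⟨f, g⟩` is `inner ℂ g f`. -/
instance : Inner ℂ FockSpace where
  inner f g := (1 / (Real.pi : ℂ)) * ∫ z : ℂ, star (f z) * g z * (Real.exp (-‖z‖ ^ 2) : ℂ)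

theorem inner_def (f g : FockSpace) :
    inner ℂ f g =
      (1 / (Real.pi : ℂ)) * ∫ z : ℂ, star (f z) * g z * (Real.exp (-‖z‖ ^ 2) : ℂ) := rfl

theorem inner_self_eq (f : FockSpace) :
    inner ℂ f f =
      (((1 / Real.pi) * ∫ z : ℂ, ‖f z‖ ^ 2 * Real.exp (-‖z‖ ^ 2) : ℝ) : ℂ) := by
  rw [inner_def]
  push_cast
  rw [← integral_complex_ofReal]
  congr 2
  funext z
  push_cast
  rw [RCLike.star_def, Complex.conj_mul']

/-- The inner product axioms. -/
instance innerCore : InnerProductSpace.Core ℂ FockSpace where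
  inner f g := inner ℂ f g
  conj_inner_symm f g := by
    rw [inner_def, inner_def, map_mul, ← integral_conj]
    congr 1
    · simp
    · congr 1
      funext z
      simp only [map_mul, Complex.conj_ofReal, RCLike.star_def, Complex.conj_conj]
      ring
  re_inner_nonneg f := by
    rw [inner_self_eq]
    simp only [RCLike.re_to_complex, Complex.ofReal_re]
    have : 0 ≤ ∫ z : ℂ, ‖f z‖ ^ 2 * Real.exp (-‖z‖ ^ 2) :=
      integral_nonneg fun z => by positivity
    have := Real.pi_pos
    positivity
  add_left f g h := by
    rw [inner_def, inner_def, inner_def, ← mul_add,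
      ← integral_add (integrable_mul f h) (integrable_mul g h)]
    congr 2
    funext z
    simp only [add_apply, star_add]
    ring
  smul_left f g k := by
    rw [inner_def, inner_def, mul_left_comm]
    congr 1
    rw [← integral_const_mul]
    congr 1
    funext z
    simp only [smul_apply, star_mul', RCLike.star_def]
    ring
  definite f hf := by
    rw [inner_self_eq, Complex.ofReal_eq_zero] at hf
    have hpi := Real.pi_pos
    have h0 : ∫ z : ℂ, ‖f z‖ ^ 2 * Real.exp (-‖z‖ ^ 2) = 0 := by
      rcases mul_eq_zero.1 hf with h | h
      · exact absurd h (by positivity)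
      · exact h
    rw [integral_eq_zero_iff_of_nonneg (fun z => by positivity) f.integrable] at h0
    have hc := f.differentiable.continuous
    have h1 := (Continuous.ae_eq_iff_eq (μ := (volume : Measure ℂ))
      (by fun_prop) continuous_const).1 h0
    ext z
    have h2 := congrFun h1 z
    rcases mul_eq_zero.1 h2 with h3 | h3
    · simpa using h3
    · exact absurd h3 (Real.exp_ne_zero _)

instance : NormedAddCommGroup FockSpace := innerCore.toNormedAddCommGroup

instance : InnerProductSpace ℂ FockSpace := InnerProductSpace.ofCore innerCore.toCore

end FockSpace

/-! ### Multi-valued linear operators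

A multi-valued linear operator in `H` is given by its graph, a linear subspace of `H × H`;
containment and equality of operators are those of graphs. -/

section Multivalued

variable {H : Type*} [NormedAddCommGroup H] [InnerProductSpace ℂ H]

/-- The graph of the `S`-adjoint of a multi-valued linear operator with graph `G`: all `(u, v)`
with `⟨g, S u⟩ = ⟨f, S v⟩` for all `(f, g) ∈ G` (the arguments of `inner` are swapped because
Mathlib's inner product is conjugate linear in the first one). -/
def adjointGraph (S : H → H) (G : Submodule ℂ (H × H)) : Set (H × H) :=
  {p | ∀ q ∈ G, inner ℂ (S p.1) q.2 = inner ℂ (S p.2) q.1}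

/-- `S`-selfadjointness of a multi-valued linear operator with graph `G`. -/
def IsSelfadjointWrt (S : H → H) (G : Submodule ℂ (H × H)) : Prop :=
  adjointGraph S G = (G : Set (H × H))

end Multivalued

/-! ### Weighted composition conjugations -/

/-- The conditions `|a| = 1`, `ā b + b̄ = 0`, `|c|² exp(|b|²) = 1`. -/
def IsConjugationParam (a b c : ℂ) : Prop :=
  ‖a‖ = 1 ∧ star a * b + star b = 0 ∧ ‖c‖ ^ 2 * Real.exp (‖b‖ ^ 2) = 1

theorem fock_conj_mem {a b c : ℂ} (h : IsConjugationParam a b c) (f : FockSpace) :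
    (fun z : ℂ => c * Complex.exp (b * z) * star (f (star (a * z + b)))) ∈ fockSubmodule := by
  obtain ⟨ha, hab, hc⟩ := h
  constructor
  · have h1 : Differentiable ℂ (fun z : ℂ => star (f (star z))) := fun z => by
      have h0 := (f.differentiable (star z)).star_star
      rw [star_star] at h0
      exact h0
    have h2 : Differentiable ℂ (fun z : ℂ => a * z + b) := by fun_prop
    have h3 : Differentiable ℂ (fun z : ℂ => c * Complex.exp (b * z)) := by fun_prop
    exact h3.mul (h1.comp h2)
  · let R : ℂ ≃ₗᵢ[ℝ] ℂ :=
      (rotation ⟨a, by simpa [Submonoid.unitSphere] using ha⟩).trans Complex.conjLIE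
    have hR : ∀ z, R z + star b = star (a * z + b) := fun z => by
      change (starRingEnd ℂ) (a * z) + star b = _
      simp
    have hmp : MeasurePreserving (fun z : ℂ => R z + star b) :=
      (measurePreserving_add_right volume (star b)).comp R.measurePreserving
    have hme : MeasurableEmbedding (fun z : ℂ => R z + star b) :=
      (MeasurableEquiv.addRight (star b)).measurableEmbedding.comp
        R.toHomeomorph.measurableEmbedding
    have hi := (hmp.integrable_comp_emb hme).2 f.integrable
    refine hi.congr ?_
    filter_upwards with z
    simp only [Function.comp_apply, hR, norm_mul, norm_star, Complex.norm_exp]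
    have key : ‖a * z + b‖ ^ 2 = ‖z‖ ^ 2 - 2 * (b * z).re + ‖b‖ ^ 2 := by
      have hab' : a * star b = -b := by
        have h5 : a * star a = 1 := by
          rw [RCLike.star_def, Complex.mul_conj']
          simp [ha]
        linear_combination a * hab - b * h5
      have e := congrArg (fun w => (w * z).re) hab'
      have e2 : a.re ^ 2 + a.im ^ 2 = 1 := by
        have := Complex.sq_norm a
        rw [ha, Complex.normSq_apply] at this
        linarith
      rw [Complex.sq_norm, Complex.sq_norm, Complex.sq_norm]
      simp only [Complex.normSq_apply, Complex.add_re, Complex.add_im, Complex.mul_re,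
        Complex.mul_im, RCLike.star_def, Complex.conj_re, Complex.conj_im, Complex.neg_re,
        Complex.neg_im] at e ⊢
      linear_combination (z.re ^ 2 + z.im ^ 2) * e2 + 2 * e
    rw [key, show -(‖z‖ ^ 2 - 2 * (b * z).re + ‖b‖ ^ 2)
      = (b * z).re + (b * z).re + (-‖z‖ ^ 2) + -(‖b‖ ^ 2) by ring, Real.exp_add, Real.exp_add,
      Real.exp_add, Real.exp_neg (‖b‖ ^ 2)]
    have hb := (Real.exp_pos (‖b‖ ^ 2)).ne'
    have hc' : (Real.exp (‖b‖ ^ 2))⁻¹ = ‖c‖ ^ 2 := (eq_inv_of_mul_eq_one_left hc).symm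
    rw [hc']
    ring

/-- The weighted composition conjugation
`(C_{a,b,c} f)(z) = c exp(bz) conj (f (conj (az + b)))` on the Fock space. -/
def weightedConjugation {a b c : ℂ} (h : IsConjugationParam a b c) : FockSpace → FockSpace :=
  fun f => ⟨fun z => c * Complex.exp (b * z) * star (f (star (a * z + b))), fock_conj_mem h f⟩

/-! ### Multi-valued weighted composition operators -/

/-- The maximal multi-valued weighted composition operator: its graph consists of all pairs
`(f, g)` in the Fock space with `psi * (f ∘ varphi) = phi * g^(m)`. -/
def maximalOperator (m : ℕ) (psi varphi phi : ℂ → ℂ) : Submodule ℂ (FockSpace × FockSpace) where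
  carrier := {p | ∀ z, psi z * p.1 (varphi z) = phi z * iteratedDeriv m (p.2 : ℂ → ℂ) z}
  zero_mem' := fun z => by
    have : ((0 : FockSpace × FockSpace).2 : ℂ → ℂ) = fun _ => 0 := rfl
    rw [this]
    simp
  add_mem' := by
    intro p q hp hq z
    have h1 : ((p + q).2 : ℂ → ℂ) = (p.2 : ℂ → ℂ) + (q.2 : ℂ → ℂ) := rfl
    rw [h1, iteratedDeriv_add p.2.differentiable.contDiff.contDiffAt
      q.2.differentiable.contDiff.contDiffAt, Prod.fst_add, FockSpace.add_apply, mul_add, mul_add,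
      hp z, hq z]
  smul_mem' := by
    intro k p hp z
    have h1 : ((k • p).2 : ℂ → ℂ) = k • (p.2 : ℂ → ℂ) := rfl
    rw [h1, iteratedDeriv_const_smul_field, Prod.smul_fst, FockSpace.smul_apply]
    have := hp z
    simp only [smul_eq_mul]
    linear_combination k * this

/-- Two triples of symbols `(psi, varphi, phi)` and `(psi', varphi, phi')`, with `psi` and `psi'`
free of zeros, are equivalent if `phi / psi = phi' / psi'`. -/
def EquivalentSymbols (psi phi psi' phi' : ℂ → ℂ) : Prop :=
  ∀ z, phi z / psi z = phi' z / psi' z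

/-- The explicit form of the symbols: `varphi(y) = A y + B` and
`C exp(D y) phi(y) = psi(y) (a (A y + B) + b)^m`, where `C ≠ 0` and `D = b + a B - b A`. -/
def HasExplicitForm (m : ℕ) (a b : ℂ) (psi varphi phi : ℂ → ℂ) : Prop :=
  ∃ A B C D : ℂ, C ≠ 0 ∧ D = b + a * B - b * A ∧ (∀ y, varphi y = A * y + B) ∧
    ∀ y, C * Complex.exp (D * y) * phi y = psi y * (a * (A * y + B) + b) ^ m

end

noncomputable section

/-! ### Gaussian integrals on the complex plane -/

/-! The engine is the reproducing property: derivatives of order `n` at `y` are inner products with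
`expMonomial n (star y)`. Since the conjugation is an isometric involution, the graph equation at
`y` says exactly that a pair is orthogonal, in the sense of the adjoint, to `kernelPair` at `y`.
Hence every kernel pair lies in the adjoint, and the adjoint is contained in the graph as soon as
every kernel pair lies in the graph.

Membership of the kernel pairs in the graph is a functional equation stating that an expression in
`x` and `y` is symmetric (`kernelPair_mem_iff`). Its logarithmic derivative in `x` at a fixed point
shows that `varphi` is affine, and its value at that point gives the relation between `phi` and
`psi` (`hasExplicitForm_of_kernelPair_mem`). Conversely the explicit form solves the equation.

What remains is that the explicit form puts the graph inside its adjoint, a symmetry of a form on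
the graph (`inner_comm_of_mem_maximalOperator`). If `A = 0`, then `m = 0` and second components are
multiples of one kernel. If `A ≠ 0`, the first component `f` is formally an integral transform of
the second with a symmetric kernel, but Fubini need not apply. So `f` is replaced by weighted
dilations of ratio `r`: for small `r` the kernel grows slowly enough for Fubini. Both sides are
holomorphic in the disc `‖r‖ < 1` and continuous on the real segment up to `r = 1`, so the identity
propagates to `r = 1`. -/

theorem integrable_exp_neg_mul_sq_norm {ε : ℝ} (hε : 0 < ε) :
    Integrable (fun z : ℂ => Real.exp (-ε * ‖z‖ ^ 2)) := by
  have h := (GaussianFourier.integrable_cexp_neg_mul_sq_norm_add (V := ℂ) (b := (ε : ℂ))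
    (by simpa using hε) 0 0).norm
  refine h.congr ?_
  filter_upwards with z
  rw [Complex.norm_exp]
  congr 1
  simp [← Complex.ofReal_pow]

theorem integral_exp_neg_sq_norm : ∫ z : ℂ, Real.exp (-‖z‖ ^ 2) = Real.pi := by
  have h := GaussianFourier.integral_rexp_neg_mul_sq_norm (V := ℂ) one_pos
  simpa using h

/-- Half of the Gaussian is spent on absorbing the growth: `x ^ n` costs one more `exp x`, and `(k +
1) ^ 2 / (2 * ε)` is the maximum of `(k + 1) * x - ε / 2 * x ^ 2`. -/
theorem pow_mul_exp_mul_exp_neg_le (n : ℕ) (k : ℝ) {ε x : ℝ} (hε : 0 < ε) (hx : 0 ≤ x) :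
    x ^ n * Real.exp (k * x) * Real.exp (-ε * x ^ 2) ≤
      n.factorial * Real.exp ((k + 1) ^ 2 / (2 * ε)) * Real.exp (-(ε / 2) * x ^ 2) := by
  have h1 : x ^ n ≤ n.factorial * Real.exp x := by
    have := Real.pow_div_factorial_le_exp x hx n
    rwa [div_le_iff₀' (by positivity)] at this
  calc x ^ n * Real.exp (k * x) * Real.exp (-ε * x ^ 2)
      ≤ n.factorial * Real.exp x * Real.exp (k * x) * Real.exp (-ε * x ^ 2) := by gcongr
    _ = n.factorial * Real.exp (x + k * x + -ε * x ^ 2) := by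
        rw [Real.exp_add, Real.exp_add]; ring
    _ ≤ n.factorial * Real.exp ((k + 1) ^ 2 / (2 * ε) + -(ε / 2) * x ^ 2) := by
        refine mul_le_mul_of_nonneg_left (Real.exp_le_exp.2 ?_) (by positivity)
        have h2 : (k + 1) ^ 2 / (2 * ε) + -(ε / 2) * x ^ 2 - (x + k * x + -ε * x ^ 2)
            = (k + 1 - ε * x) ^ 2 / (2 * ε) := by
          field_simp
          ring
        have h3 : 0 ≤ (k + 1 - ε * x) ^ 2 / (2 * ε) := by positivity
        linarith
    _ = _ := by rw [Real.exp_add]; ring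

theorem integrable_pow_mul_exp_mul_exp_neg (n : ℕ) (k : ℝ) {ε : ℝ} (hε : 0 < ε) :
    Integrable (fun z : ℂ => ‖z‖ ^ n * Real.exp (k * ‖z‖) * Real.exp (-ε * ‖z‖ ^ 2)) := by
  refine ((integrable_exp_neg_mul_sq_norm (half_pos hε)).const_mul
    (n.factorial * Real.exp ((k + 1) ^ 2 / (2 * ε)))).mono' ?_ ?_
  · exact Continuous.aestronglyMeasurable (by fun_prop)
  · filter_upwards with z
    rw [Real.norm_of_nonneg (by positivity)]
    exact pow_mul_exp_mul_exp_neg_le n k hε (norm_nonneg z)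

/-- The mean value property with respect to the Gaussian measure. -/
theorem integral_mul_exp_neg_sq_norm {f : ℂ → ℂ} (hf : Differentiable ℂ f)
    (hi : Integrable (fun z : ℂ => f z * (Real.exp (-‖z‖ ^ 2) : ℂ))) :
    ∫ z : ℂ, f z * (Real.exp (-‖z‖ ^ 2) : ℂ) = Real.pi * f 0 := by
  set F : ℂ → ℂ := fun z => f z * (Real.exp (-‖z‖ ^ 2) : ℂ) with hF
  have hFc : Continuous F := by
    have := hf.continuous
    fun_prop
  -- Rotations preserve Lebesgue measure and the Gaussian, so the integral equals its average over
  -- `θ`. After Fubini, the inner average is the circle mean of `f`, namely `f 0`.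
  set u : ℝ → ℂ → ℂ := fun θ z => F (Complex.exp (θ * Complex.I) * z) with hu
  have hmp : ∀ θ : ℝ, MeasurePreserving (fun z : ℂ => Complex.exp (θ * Complex.I) * z) := by
    intro θ
    have := (rotation (Circle.exp θ)).measurePreserving
    convert this using 2 with z
    simp [rotation_apply]
  have hme : ∀ θ : ℝ, MeasurableEmbedding (fun z : ℂ => Complex.exp (θ * Complex.I) * z) := by
    intro θ
    have := (rotation (Circle.exp θ)).toHomeomorph.measurableEmbedding
    convert this using 2 with z
    simp [rotation_apply]
  have hint : ∀ θ, Integrable (u θ) := fun θ => (hmp θ).integrable_comp_emb (hme θ) |>.2 hi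
  have hval : ∀ θ, ∫ z, u θ z = ∫ z, F z := fun θ => (hmp θ).integral_comp (hme θ) F
  have hvaln : ∀ θ, ∫ z, ‖u θ z‖ = ∫ z, ‖F z‖ := fun θ =>
    (hmp θ).integral_comp (hme θ) (fun z => ‖F z‖)
  have hprod : Integrable (Function.uncurry u)
      ((volume.restrict (Set.Ioc 0 (2 * Real.pi))).prod volume) := by
    rw [integrable_prod_iff]
    · refine ⟨.of_forall hint, ?_⟩
      simp only [Function.uncurry_apply_pair, hvaln]
      exact integrable_const _
    · refine Continuous.aestronglyMeasurable ?_
      simp only [hu, Function.uncurry_def]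
      fun_prop
  have hswap := integral_integral_swap hprod
  simp only [hval] at hswap
  have hav : ∀ z : ℂ, ∫ θ in Set.Ioc 0 (2 * Real.pi), u θ z
      = 2 * Real.pi * f 0 * (Real.exp (-‖z‖ ^ 2) : ℂ) := by
    intro z
    have h1 : Real.circleAverage (fun w => f (w * z)) 0 1 = f (0 * z) :=
      DiffContOnCl.circleAverage (f := fun w => f (w * z))
        (Differentiable.diffContOnCl (by fun_prop))
    rw [Real.circleAverage_def, zero_mul, inv_smul_eq_iff₀ (by positivity),
      intervalIntegral.integral_of_le (by positivity)] at h1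
    rw [show (2 * Real.pi * f 0 : ℂ) = (2 * Real.pi : ℝ) • f 0 by simp, ← h1,
      ← integral_mul_const]
    refine integral_congr_ae (.of_forall fun θ => ?_)
    simp [hu, hF, circleMap, Complex.norm_exp]
  rw [integral_congr_ae (.of_forall hav), integral_const_mul, integral_complex_ofReal,
    integral_exp_neg_sq_norm] at hswap
  have hpi : (2 * Real.pi : ℂ) ≠ 0 := by
    exact_mod_cast Real.two_pi_pos.ne'
  simp only [integral_const, Measure.real, Measure.restrict_apply_univ, Real.volume_Ioc, sub_zero,
    ENNReal.toReal_ofReal Real.two_pi_pos.le, Complex.real_smul] at hswap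
  push_cast at hswap
  apply mul_left_cancel₀ hpi
  rw [hswap]
  ring

/-- An integral depending holomorphically on a parameter is holomorphic. -/
theorem hasDerivAt_integral_of_locally_dominated {F : ℂ → ℂ → ℂ}
    (hF : Continuous (fun p : ℂ × ℂ => F p.2 p.1)) {x₀ : ℂ} {r : ℝ} (hr : 0 < r)
    (hd : ∀ z, DifferentiableOn ℂ (fun x => F x z) (Metric.ball x₀ r)) {bound : ℂ → ℝ}
    (hb : Integrable bound) (hle : ∀ z, ∀ x ∈ Metric.ball x₀ r, ‖F x z‖ ≤ bound z) :
    Integrable (fun z => deriv (fun x => F x z) x₀) ∧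
    HasDerivAt (fun x => ∫ z, F x z) (∫ z, deriv (fun x => F x z) x₀) x₀ := by
  -- Room for the Cauchy estimate, which bounds the derivative by `bound z / (r / 3)` on the half
  -- ball.
  have hball : ∀ x ∈ Metric.ball x₀ (r / 2), Metric.closedBall x (r / 3) ⊆ Metric.ball x₀ r := by
    intro x hx y hy
    rw [Metric.mem_ball] at *
    rw [Metric.mem_closedBall] at hy
    linarith [dist_triangle y x x₀]
  refine hasDerivAt_integral_of_dominated_loc_of_deriv_le (bound := fun z => bound z / (r / 3))
    (s := Metric.ball x₀ (r / 2)) (F' := fun x z => deriv (fun x => F x z) x)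
    (Metric.ball_mem_nhds _ (half_pos hr)) ?_ ?_ ?_ ?_ (hb.div_const _) ?_
  · exact .of_forall fun x => Continuous.aestronglyMeasurable
      (hF.comp (by fun_prop : Continuous fun z : ℂ => (z, x)))
  · refine hb.mono' (Continuous.aestronglyMeasurable
      (hF.comp (by fun_prop : Continuous fun z : ℂ => (z, x₀)))) (.of_forall fun z => ?_)
    exact hle z x₀ (Metric.mem_ball_self hr)
  · have h := stronglyMeasurable_deriv_with_param (f := fun z x => F x z) hF
    exact (h.comp_measurable (by fun_prop : Measurable fun z : ℂ => (z, x₀))).aestronglyMeasurable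
  · refine .of_forall fun z x hx => ?_
    refine Complex.norm_deriv_le_of_forall_mem_sphere_norm_le (by positivity) ?_ ?_
    · refine DifferentiableOn.diffContOnCl ?_
      refine (hd z).mono (subset_trans Metric.closure_ball_subset_closedBall (hball x hx))
    · intro y hy
      exact hle z y (hball x hx (Metric.sphere_subset_closedBall hy))
  · refine .of_forall fun z x hx => ?_
    refine ((hd z).differentiableAt (Metric.isOpen_ball.mem_nhds ?_)).hasDerivAt
    exact hball x hx (Metric.mem_closedBall_self (by positivity))

namespace FockSpace

/-! ### Reproducing kernels -/

theorem continuous (f : FockSpace) : Continuous (f : ℂ → ℂ) := f.differentiable.continuous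

/-- Square integrability of `f` uses up the weight `exp (-‖z‖ ^ 2 / 2)`; any surplus Gaussian decay
makes the other factor square integrable as well. The threshold `1 / 2` governs all later domination
arguments. -/
theorem integrable_norm_mul (f : FockSpace) (n : ℕ) (k : ℝ) {ε : ℝ} (hε : 1 / 2 < ε) :
    Integrable (fun z : ℂ =>
      ‖f z‖ * (‖z‖ ^ n * Real.exp (k * ‖z‖) * Real.exp (-ε * ‖z‖ ^ 2))) := by
  refine (f.integrable.add (integrable_pow_mul_exp_mul_exp_neg (2 * n) (2 * k)
    (ε := 2 * ε - 1) (by linarith))).mono' ?_ ?_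
  · have := f.continuous
    exact Continuous.aestronglyMeasurable (by fun_prop)
  · filter_upwards with z
    rw [Real.norm_of_nonneg (by positivity)]
    set A := ‖f z‖ * Real.exp (-(1 / 2) * ‖z‖ ^ 2) with hA
    set B := ‖z‖ ^ n * Real.exp (k * ‖z‖) * Real.exp (-(ε - 1 / 2) * ‖z‖ ^ 2) with hB
    have h1 : ‖f z‖ * (‖z‖ ^ n * Real.exp (k * ‖z‖) * Real.exp (-ε * ‖z‖ ^ 2)) = A * B := by
      rw [show -ε * ‖z‖ ^ 2 = -(1 / 2) * ‖z‖ ^ 2 + -(ε - 1 / 2) * ‖z‖ ^ 2 by ring, Real.exp_add]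
      ring
    have h2 : ‖f z‖ ^ 2 * Real.exp (-‖z‖ ^ 2) = A ^ 2 := by
      rw [hA, mul_pow, ← Real.exp_nat_mul]
      congr 2
      push_cast
      ring
    have h3 : ‖z‖ ^ (2 * n) * Real.exp (2 * k * ‖z‖) * Real.exp (-(2 * ε - 1) * ‖z‖ ^ 2) =
        B ^ 2 := by
      rw [hB, mul_pow, mul_pow, ← Real.exp_nat_mul, ← Real.exp_nat_mul, ← pow_mul, mul_comm n 2]
      congr 1
      · congr 2
        push_cast
        ring
      · congr 1
        push_cast
        ring
    simp only [Pi.add_apply]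
    rw [h1, h2, h3]
    nlinarith [sq_nonneg (A - B), sq_nonneg A, sq_nonneg B]

/-- The function `z ↦ zⁿ exp(sz)`, the reproducing kernel of the `n`-th derivative
at the conjugate of `s`. -/
def expMonomial (n : ℕ) (s : ℂ) : FockSpace :=
  ⟨fun z => z ^ n * Complex.exp (s * z), by
    refine ⟨by fun_prop, ?_⟩
    refine (integrable_pow_mul_exp_mul_exp_neg (2 * n) (2 * ‖s‖) one_pos).mono' ?_ ?_
    · exact Continuous.aestronglyMeasurable (by fun_prop)
    · filter_upwards with z
      rw [Real.norm_of_nonneg (by positivity), norm_mul, norm_pow, mul_pow, ← pow_mul,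
        mul_comm n 2, Complex.norm_exp, ← Real.exp_nat_mul, neg_one_mul]
      refine mul_le_mul_of_nonneg_right (mul_le_mul_of_nonneg_left (Real.exp_le_exp.2 ?_)
        (by positivity)) (by positivity)
      have h := (Complex.re_le_norm (s * z)).trans_eq (norm_mul s z)
      push_cast
      linarith⟩

@[simp] theorem expMonomial_apply (n : ℕ) (s z : ℂ) :
    expMonomial n s z = z ^ n * Complex.exp (s * z) := rfl

theorem ofReal_sq_norm (z : ℂ) : ((‖z‖ ^ 2 : ℝ) : ℂ) = z * star z := by
  rw [RCLike.star_def, Complex.mul_conj', Complex.ofReal_pow]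

theorem inner_expMonomial_zero (f : FockSpace) (s : ℂ) :
    inner ℂ (expMonomial 0 s) f = f (star s) := by
  have hpi : (Real.pi : ℂ) ≠ 0 := by exact_mod_cast Real.pi_ne_zero
  set G : ℂ → ℂ := fun z => star (expMonomial 0 s z) * f z * (Real.exp (-‖z‖ ^ 2) : ℂ) with hG
  -- Translation by `star s` completes the square in the exponent, leaving an entire function times
  -- the centred Gaussian, to which the mean value property applies.
  have key : ∀ z, G (z + star s) =
      f (z + star s) * Complex.exp (-(z * s)) * (Real.exp (-‖z‖ ^ 2) : ℂ) := by
    intro z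
    simp only [hG, expMonomial_apply, pow_zero, one_mul]
    rw [Complex.ofReal_exp, Complex.ofReal_exp, RCLike.star_def, ← Complex.exp_conj,
      mul_comm _ (f _), mul_assoc, mul_assoc, ← Complex.exp_add, ← Complex.exp_add]
    congr 2
    rw [Complex.ofReal_neg, Complex.ofReal_neg, ← RCLike.star_def, ofReal_sq_norm, ofReal_sq_norm]
    simp only [star_mul', star_add, star_star]
    ring
  have hint : Integrable G := integrable_mul _ f
  have hmean := integral_mul_exp_neg_sq_norm
    (f := fun z => f (z + star s) * Complex.exp (-(z * s)))
    (by have := f.differentiable; fun_prop)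
    ((hint.comp_add_right (star s)).congr (.of_forall key))
  rw [inner_def]
  change (1 / (Real.pi : ℂ)) * ∫ z, G z = _
  rw [← integral_add_right_eq_self G (star s), integral_congr_ae (.of_forall key), hmean]
  field_simp
  simp

theorem hasDerivAt_inner_expMonomial (f : FockSpace) (n : ℕ) (w : ℂ) :
    HasDerivAt (fun x => inner ℂ (expMonomial n (star x)) f)
      (inner ℂ (expMonomial (n + 1) (star w)) f) w := by
  have hfc := f.continuous
  have h := hasDerivAt_integral_of_locally_dominated (x₀ := w) (r := 1)
    (F := fun x z => star (expMonomial n (star x) z) * f z * (Real.exp (-‖z‖ ^ 2) : ℂ))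
    (bound := fun z => ‖f z‖ *
      (‖z‖ ^ n * Real.exp ((‖w‖ + 1) * ‖z‖) * Real.exp (-(3 / 4) * ‖z‖ ^ 2)))
    (by simp only [expMonomial_apply]; fun_prop) one_pos ?_
    (f.integrable_norm_mul n (‖w‖ + 1) (by norm_num)) ?_
  · have h2 := h.2.const_mul (1 / (Real.pi : ℂ))
    rw [inner_def]
    refine h2.congr_deriv ?_
    congr 2
    funext z
    have : (fun x => star (expMonomial n (star x) z) * f z * (Real.exp (-‖z‖ ^ 2) : ℂ)) =
        fun x => Complex.exp (x * star z) * (star z ^ n * f z * (Real.exp (-‖z‖ ^ 2) : ℂ)) := by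
      funext x
      simp only [expMonomial_apply, star_mul', star_pow, RCLike.star_def, ← Complex.exp_conj,
        map_mul, Complex.conj_conj]
      ring
    rw [this]
    have hd : HasDerivAt (fun x => Complex.exp (x * star z))
        (Complex.exp (w * star z) * star z) w := by
      simpa using ((hasDerivAt_id w).mul_const (star z)).cexp
    rw [(hd.mul_const _).deriv]
    simp only [expMonomial_apply, star_mul', star_pow, RCLike.star_def, ← Complex.exp_conj,
        map_mul, Complex.conj_conj]
    ring
  · intro z
    simp only [expMonomial_apply, star_mul', star_pow, RCLike.star_def, ← Complex.exp_conj,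
        map_mul, Complex.conj_conj]
    fun_prop
  · intro z x hx
    have hx' : ‖x‖ ≤ ‖w‖ + 1 := by
      rw [mem_ball_iff_norm] at hx
      linarith [norm_sub_norm_le x w]
    rw [expMonomial_apply, norm_mul, norm_mul, norm_star, norm_mul, norm_pow, Complex.norm_exp,
      Complex.norm_real, Real.norm_of_nonneg (Real.exp_pos _).le, mul_comm _ ‖f z‖, mul_assoc]
    gcongr
    · refine (Complex.re_le_norm _).trans ?_
      rw [norm_mul, norm_star]
      gcongr
    · nlinarith [sq_nonneg ‖z‖]

theorem inner_expMonomial (f : FockSpace) (n : ℕ) (w : ℂ) :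
    inner ℂ (expMonomial n (star w)) f = iteratedDeriv n (f : ℂ → ℂ) w := by
  induction n generalizing w with
  | zero => rw [inner_expMonomial_zero, star_star, iteratedDeriv_zero]
  | succ n ih =>
    rw [iteratedDeriv_succ, ← (funext ih : (fun x => inner ℂ (expMonomial n (star x)) f) = _),
      (hasDerivAt_inner_expMonomial f n w).deriv]

/-- Cauchy–Schwarz against the kernel at `w`, whose squared norm is its own value at `w`. -/
theorem norm_apply_le (f : FockSpace) (w : ℂ) : ‖f w‖ ≤ ‖f‖ * Real.exp (‖w‖ ^ 2 / 2) := by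
  have h := norm_inner_le_norm (𝕜 := ℂ) (expMonomial 0 (star w)) f
  have h1 : inner ℂ (expMonomial 0 (star w)) f = f w := by
    rw [inner_expMonomial_zero, star_star]
  have h2 : ‖expMonomial 0 (star w)‖ ^ 2 = Real.exp (‖w‖ ^ 2 / 2) ^ 2 := by
    have h3 := norm_sq_eq_re_inner (𝕜 := ℂ) (expMonomial 0 (star w))
    have h4 : inner ℂ (expMonomial 0 (star w)) (expMonomial 0 (star w)) =
        (Real.exp (‖w‖ ^ 2) : ℂ) := by
      rw [inner_expMonomial_zero, star_star, expMonomial_apply, pow_zero, one_mul,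
        RCLike.star_def, Complex.conj_mul', Complex.ofReal_exp]
      push_cast
      rfl
    rw [h3, h4, RCLike.re_to_complex, Complex.ofReal_re, ← Real.exp_nat_mul]
    congr 1
    push_cast
    ring
  have h6 := (pow_left_inj₀ (norm_nonneg _) (Real.exp_pos _).le two_ne_zero).1 h2
  rw [← h6, mul_comm]
  exact (le_of_eq (by rw [← h1])).trans h

end FockSpace

/-! ### Properties of the weighted composition conjugation -/

section Conjugation

variable {a b c : ℂ}

namespace IsConjugationParam

theorem mul_star (h : IsConjugationParam a b c) : a * star a = 1 := by
  rw [RCLike.star_def, Complex.mul_conj', h.1]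
  simp

theorem mul_star_right (h : IsConjugationParam a b c) : a * star b = -b := by
  linear_combination a * h.2.1 - b * h.mul_star

theorem ne_zero (h : IsConjugationParam a b c) : a ≠ 0 := by
  intro h0
  simpa [h0] using h.1

theorem const_ne_zero (h : IsConjugationParam a b c) : c ≠ 0 := by
  intro h0
  simpa [h0] using h.2.2

theorem star_mul_const (h : IsConjugationParam a b c) :
    star c * c * Complex.exp (b * star b) = 1 := by
  rw [← FockSpace.ofReal_sq_norm, RCLike.star_def, Complex.conj_mul', ← Complex.ofReal_exp]
  exact_mod_cast h.2.2

theorem sq_norm_eq (h : IsConjugationParam a b c) (z : ℂ) :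
    ((‖star (a * z + b)‖ ^ 2 : ℝ) : ℂ) =
      (‖z‖ ^ 2 : ℝ) - b * z - star (b * z) + b * star b := by
  rw [FockSpace.ofReal_sq_norm, FockSpace.ofReal_sq_norm, star_star]
  have h1 := h.mul_star
  have h2 := h.mul_star_right
  have h3 := congrArg star h2
  simp only [star_mul', star_star, star_neg] at h3
  simp only [star_add, star_mul']
  linear_combination z * star z * h1 + z * h2 + star z * h3

end IsConjugationParam

@[simp] theorem weightedConjugation_apply (h : IsConjugationParam a b c) (f : FockSpace) (z : ℂ) :
    weightedConjugation h f z = c * Complex.exp (b * z) * star (f (star (a * z + b))) := rfl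

@[simp] theorem weightedConjugation_weightedConjugation (h : IsConjugationParam a b c)
    (f : FockSpace) : weightedConjugation h (weightedConjugation h f) = f := by
  ext z
  have h1 := h.mul_star
  have h2 := h.mul_star_right
  have h3 := congrArg star h2
  simp only [star_mul', star_star, star_neg] at h3
  have harg : star (a * star (a * z + b) + b) = z := by
    simp only [star_add, star_mul', star_star]
    linear_combination z * h1 + h3
  have hexp : star (Complex.exp (b * star (a * z + b))) =
      Complex.exp (-(b * z)) * Complex.exp (b * star b) := by
    rw [RCLike.star_def, ← Complex.exp_conj, ← Complex.exp_add, ← RCLike.star_def]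
    congr 1
    simp only [star_mul', star_star]
    linear_combination z * h2
  simp only [weightedConjugation_apply]
  rw [star_mul', star_mul', hexp, star_star, harg, Complex.exp_neg]
  have hne := Complex.exp_ne_zero (b * z)
  field_simp
  linear_combination f z * h.star_mul_const

/-- The map `z ↦ star (a * z + b)` is an isometry of the plane, and by `sq_norm_eq` the weight `c *
exp (b * z)` exactly compensates the displacement of the Gaussian. -/
theorem inner_weightedConjugation_weightedConjugation (h : IsConjugationParam a b c)
    (f g : FockSpace) :
    inner ℂ (weightedConjugation h f) (weightedConjugation h g) = inner ℂ g f := by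
  let R : ℂ ≃ₗᵢ[ℝ] ℂ :=
    (rotation ⟨a, by simpa [Submonoid.unitSphere] using h.1⟩).trans Complex.conjLIE
  have hR : ∀ z, R z + star b = star (a * z + b) := fun z => by
    change (starRingEnd ℂ) (a * z) + star b = _
    simp
  have hmp : MeasurePreserving (fun z : ℂ => R z + star b) :=
    (measurePreserving_add_right volume (star b)).comp R.measurePreserving
  have hme : MeasurableEmbedding (fun z : ℂ => R z + star b) :=
    (MeasurableEquiv.addRight (star b)).measurableEmbedding.comp
      R.toHomeomorph.measurableEmbedding
  rw [FockSpace.inner_def, FockSpace.inner_def]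
  congr 1
  refine Eq.trans ?_ (hmp.integral_comp hme
    fun z => star (g z) * f z * (Real.exp (-‖z‖ ^ 2) : ℂ))
  refine integral_congr_ae (.of_forall fun z => ?_)
  simp only [hR, weightedConjugation_apply]
  rw [Complex.ofReal_exp, Complex.ofReal_exp, Complex.ofReal_neg, Complex.ofReal_neg,
    h.sq_norm_eq, star_mul', star_mul', star_star, RCLike.star_def, ← Complex.exp_conj,
    ← RCLike.star_def, show -(((‖z‖ ^ 2 : ℝ) : ℂ) - b * z - star (b * z) + b * star b) =
      -((‖z‖ ^ 2 : ℝ) : ℂ) + b * z + star (b * z) + -(b * star b) by ring, Complex.exp_add,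
    Complex.exp_add, Complex.exp_add, Complex.exp_neg (b * star b)]
  have hne := Complex.exp_ne_zero (b * star b)
  have hc := h.star_mul_const
  generalize f.1 (star (a * z + b)) = F
  generalize g.1 (star (a * z + b)) = G
  field_simp
  linear_combination star G * F * hc

theorem inner_weightedConjugation_comm (h : IsConjugationParam a b c) (f g : FockSpace) :
    inner ℂ (weightedConjugation h f) g = inner ℂ (weightedConjugation h g) f := by
  conv_lhs => rw [← weightedConjugation_weightedConjugation h g]
  exact inner_weightedConjugation_weightedConjugation h f _

/-- The conjugate `C_{a,b,c} K` of the reproducing kernel `K` of the `n`-th derivative at `y`. -/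
def conjKernel (h : IsConjugationParam a b c) (n : ℕ) (y : ℂ) : FockSpace :=
  weightedConjugation h (FockSpace.expMonomial n (star y))

theorem conjKernel_apply (h : IsConjugationParam a b c) (n : ℕ) (y z : ℂ) :
    conjKernel h n y z = c * Complex.exp (b * z) *
      ((a * z + b) ^ n * Complex.exp ((a * z + b) * y)) := by
  rw [conjKernel, weightedConjugation_apply, FockSpace.expMonomial_apply, star_mul', star_pow,
    star_star, RCLike.star_def, ← Complex.exp_conj, ← RCLike.star_def, star_mul', star_star,
    star_star, mul_comm y]

theorem inner_weightedConjugation_conjKernel (h : IsConjugationParam a b c) (n : ℕ) (y : ℂ)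
    (f : FockSpace) :
    inner ℂ (weightedConjugation h f) (conjKernel h n y) = iteratedDeriv n (f : ℂ → ℂ) y := by
  rw [conjKernel, inner_weightedConjugation_weightedConjugation, FockSpace.inner_expMonomial]

/-- The exponent `b * z + (a * z + b) * y` is symmetric in `y` and `z`, so as a function of `z` the
kernel is a pure exponential of rate `a * y + b`. -/
theorem iteratedDeriv_conjKernel_zero (h : IsConjugationParam a b c) (n : ℕ) (y x : ℂ) :
    iteratedDeriv n (conjKernel h 0 y : ℂ → ℂ) x =
      c * Complex.exp (b * y) * (a * y + b) ^ n * Complex.exp ((a * y + b) * x) := by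
  have h1 : (conjKernel h 0 y : ℂ → ℂ) =
      fun z => (c * Complex.exp (b * y)) * Complex.exp ((a * y + b) * z) := by
    funext z
    rw [conjKernel_apply, pow_zero, one_mul, mul_assoc, mul_assoc, ← Complex.exp_add,
      ← Complex.exp_add]
    congr 2
    ring
  rw [h1, iteratedDeriv_const_mul_field, iteratedDeriv_cexp_const_mul]
  ring

/-! ### The adjoint of the maximal operator -/

/-- The pairs spanning the adjoint of the maximal operator. -/
def kernelPair (h : IsConjugationParam a b c) (m : ℕ) (psi varphi phi : ℂ → ℂ) (y : ℂ) :
    FockSpace × FockSpace :=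
  (phi y • conjKernel h m y, psi y • conjKernel h 0 (varphi y))

theorem mem_maximalOperator {m : ℕ} {psi varphi phi : ℂ → ℂ} {p : FockSpace × FockSpace} :
    p ∈ maximalOperator m psi varphi phi ↔
      ∀ z, psi z * p.1 (varphi z) = phi z * iteratedDeriv m (p.2 : ℂ → ℂ) z := Iff.rfl

theorem mem_adjointGraph_iff {H : Type*} [NormedAddCommGroup H] [InnerProductSpace ℂ H]
    {S : H → H} {G : Submodule ℂ (H × H)} {p : H × H} :
    p ∈ adjointGraph S G ↔ ∀ q ∈ G, inner ℂ (S p.1) q.2 = inner ℂ (S p.2) q.1 := Iff.rfl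

theorem kernelPair_mem_adjointGraph (h : IsConjugationParam a b c) (m : ℕ)
    (psi varphi phi : ℂ → ℂ) (y : ℂ) :
    kernelPair h m psi varphi phi y ∈
      adjointGraph (weightedConjugation h) (maximalOperator m psi varphi phi) := by
  rw [mem_adjointGraph_iff]
  intro q hq
  rw [inner_weightedConjugation_comm h _ q.1, inner_weightedConjugation_comm h _ q.2]
  simp only [kernelPair]
  rw [inner_smul_right, inner_smul_right, inner_weightedConjugation_conjKernel,
    inner_weightedConjugation_conjKernel, iteratedDeriv_zero]
  exact (hq y).symm

/-- Testing the adjoint relation of `p` on the kernel pair at `y` returns the graph equation of `p`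
at `y`. -/
theorem adjointGraph_subset_of_kernelPair_mem (h : IsConjugationParam a b c) {m : ℕ}
    {psi varphi phi : ℂ → ℂ}
    (hmem : ∀ y, kernelPair h m psi varphi phi y ∈ maximalOperator m psi varphi phi) :
    adjointGraph (weightedConjugation h) (maximalOperator m psi varphi phi) ⊆
      (maximalOperator m psi varphi phi : Set (FockSpace × FockSpace)) := by
  intro p hp y
  have h1 := hp _ (hmem y)
  simpa only [kernelPair, inner_smul_right, inner_weightedConjugation_conjKernel,
    iteratedDeriv_zero] using h1

theorem kernelPair_mem_iff (h : IsConjugationParam a b c) (m : ℕ)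
    (psi varphi phi : ℂ → ℂ) (y : ℂ) :
    kernelPair h m psi varphi phi y ∈ maximalOperator m psi varphi phi ↔
      ∀ x, psi x * phi y * (a * varphi x + b) ^ m *
          Complex.exp (b * varphi x + (a * varphi x + b) * y) =
        phi x * psi y * (a * varphi y + b) ^ m *
          Complex.exp (b * varphi y + (a * varphi y + b) * x) := by
  rw [mem_maximalOperator]
  refine forall_congr' fun x => ?_
  have h2 : (((psi y • conjKernel h 0 (varphi y) : FockSpace)) : ℂ → ℂ) =
      fun z => psi y * (conjKernel h 0 (varphi y)) z := rfl
  rw [kernelPair, FockSpace.smul_apply, conjKernel_apply, h2, iteratedDeriv_const_mul_field,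
    iteratedDeriv_conjKernel_zero, Complex.exp_add, Complex.exp_add]
  conv_rhs => rw [← mul_right_inj' h.const_ne_zero]
  refine Eq.congr ?_ ?_ <;> ring_nf

end Conjugation

/-! ### The functional equation for the symbols -/

section Symbols

variable {m : ℕ} {a b c : ℂ} {psi varphi phi : ℂ → ℂ}

theorem Differentiable.eq_zero_or_eq_zero_of_forall_mul_eq_zero {f g : ℂ → ℂ}
    (hf : Differentiable ℂ f) (hg : Differentiable ℂ g) (h : ∀ z, f z * g z = 0) :
    (∀ z, f z = 0) ∨ ∀ z, g z = 0 := by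
  have := AnalyticOnNhd.eq_zero_or_eq_zero_of_mul_eq_zero (U := Set.univ)
    (fun z _ => hf.analyticAt z) (fun z _ => hg.analyticAt z) (fun z _ => h z) isPreconnected_univ
  simpa using this

/-- The explicit form depends on the symbols only through `varphi` and the quotient `phi / psi`. -/
theorem HasExplicitForm.of_equivalentSymbols {psi' phi' : ℂ → ℂ}
    (h : HasExplicitForm m a b psi' varphi phi') (hpsi : ∀ z, psi z ≠ 0) (hpsi' : ∀ z, psi' z ≠ 0)
    (he : EquivalentSymbols psi phi psi' phi') : HasExplicitForm m a b psi varphi phi := by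
  obtain ⟨A, B, C, D, hC, hD, hv, hf⟩ := h
  refine ⟨A, B, C, D, hC, hD, hv, fun y => ?_⟩
  have h1 := (div_eq_div_iff (hpsi y) (hpsi' y)).1 (he y)
  apply mul_left_cancel₀ (hpsi' y)
  linear_combination C * Complex.exp (D * y) * h1 + psi y * hf y

theorem kernelPair_mem_of_hasExplicitForm (h : IsConjugationParam a b c)
    (he : HasExplicitForm m a b psi varphi phi) (y : ℂ) :
    kernelPair h m psi varphi phi y ∈ maximalOperator m psi varphi phi := by
  obtain ⟨A, B, C, D, hC, hD, hv, hf⟩ := he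
  rw [kernelPair_mem_iff]
  intro x
  have hphi : ∀ y, C * phi y = psi y * (a * varphi y + b) ^ m * Complex.exp (-(D * y)) := by
    intro y
    rw [hv, ← hf, Complex.exp_neg]
    have := Complex.exp_ne_zero (D * y)
    field_simp
  have hexp : Complex.exp (-(D * y)) * Complex.exp (b * varphi x + (a * varphi x + b) * y) =
      Complex.exp (-(D * x)) * Complex.exp (b * varphi y + (a * varphi y + b) * x) := by
    rw [← Complex.exp_add, ← Complex.exp_add, hv, hv, hD]
    congr 1
    ring
  apply mul_left_cancel₀ hC
  linear_combination psi x * (a * varphi x + b) ^ m *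
      Complex.exp (b * varphi x + (a * varphi x + b) * y) * hphi y -
    psi y * (a * varphi y + b) ^ m *
      Complex.exp (b * varphi y + (a * varphi y + b) * x) * hphi x +
    psi x * psi y * (a * varphi x + b) ^ m * (a * varphi y + b) ^ m * hexp

theorem hasExplicitForm_of_kernelPair_mem (h : IsConjugationParam a b c)
    (hpsi : Differentiable ℂ psi) (hvarphi : Differentiable ℂ varphi)
    (hphi : Differentiable ℂ phi) (hphi0 : ∃ z, phi z ≠ 0) (hpsi0 : ∀ z, psi z ≠ 0)
    (hconst : 1 ≤ m → ∃ z w, varphi z ≠ varphi w)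
    (hmem : ∀ y, kernelPair h m psi varphi phi y ∈ maximalOperator m psi varphi phi) :
    HasExplicitForm m a b psi varphi phi := by
  have ha := h.ne_zero
  have hfe : ∀ x y, psi x * phi y * (a * varphi x + b) ^ m *
          Complex.exp (b * varphi x + (a * varphi x + b) * y) =
        phi x * psi y * (a * varphi y + b) ^ m *
          Complex.exp (b * varphi y + (a * varphi y + b) * x) :=
    fun x y => (kernelPair_mem_iff h m psi varphi phi y).1 (hmem y) x
  -- A base point where both sides can be divided: otherwise a product of entire functions vanishes
  -- identically, so one factor does. This is where nonconstancy of `varphi` for `m ≥ 1` enters.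
  obtain ⟨x₀, hx₁, hx₂⟩ : ∃ x₀, phi x₀ ≠ 0 ∧ (a * varphi x₀ + b) ^ m ≠ 0 := by
    by_contra! hcon
    have hprod : ∀ z, phi z * (a * varphi z + b) ^ m = 0 := fun z => by
      by_cases hz : phi z = 0
      · simp [hz]
      · simp [hcon z hz]
    rcases hphi.eq_zero_or_eq_zero_of_forall_mul_eq_zero
      (g := fun z => (a * varphi z + b) ^ m) (by fun_prop) hprod with h0 | h0
    · obtain ⟨z, hz⟩ := hphi0
      exact hz (h0 z)
    · rcases Nat.eq_zero_or_pos m with rfl | hm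
      · simpa using h0 0
      · obtain ⟨z, w, hzw⟩ := hconst hm
        have h1 := eq_zero_of_pow_eq_zero (h0 z)
        have h2 := eq_zero_of_pow_eq_zero (h0 w)
        exact hzw (mul_left_cancel₀ ha (by linear_combination h1 - h2))
  set P : ℂ → ℂ := fun x => psi x * (a * varphi x + b) ^ m * Complex.exp (b * varphi x) with hP
  have hPd : Differentiable ℂ P := by fun_prop
  have hP0 : P x₀ ≠ 0 := mul_ne_zero (mul_ne_zero (hpsi0 _) hx₂) (Complex.exp_ne_zero _)
  have hfeP : ∀ x y, P x * phi y * Complex.exp ((a * varphi x + b) * y) =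
      phi x * P y * Complex.exp ((a * varphi y + b) * x) := by
    intro x y
    have := hfe x y
    rw [Complex.exp_add, Complex.exp_add] at this
    linear_combination this
  set A := deriv varphi x₀ with hA
  -- Logarithmic differentiation of `hfeP` in `x` at `x₀` gives `P' / P + a * A * y = phi' / phi + a
  -- * varphi y + b`; `B` is the constant term of the solution for `varphi y`.
  set B := ((phi x₀ * deriv P x₀ - P x₀ * deriv phi x₀) / (P x₀ * phi x₀) - b) / a with hB
  have haff : ∀ y, varphi y = A * y + B := by
    -- The division by `phi y` is legitimate only off the zeros of `phi`; the factor `phi y` lets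
    -- the identity theorem remove this restriction.
    have hz : ∀ y, phi y * (varphi y - (A * y + B)) = 0 := by
      intro y
      by_cases hy : phi y = 0
      · simp [hy]
      have h1 : HasDerivAt (fun x => P x * phi y * Complex.exp ((a * varphi x + b) * y))
          (deriv P x₀ * phi y * Complex.exp ((a * varphi x₀ + b) * y) + P x₀ * phi y *
            (Complex.exp ((a * varphi x₀ + b) * y) * (a * A * y))) x₀ :=
        ((hPd x₀).hasDerivAt.mul_const _).mul
          ((((hvarphi x₀).hasDerivAt.const_mul a).add_const b).mul_const y).cexp
      have h2 : HasDerivAt (fun x => phi x * P y * Complex.exp ((a * varphi y + b) * x))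
          (deriv phi x₀ * P y * Complex.exp ((a * varphi y + b) * x₀) + phi x₀ * P y *
            (Complex.exp ((a * varphi y + b) * x₀) * ((a * varphi y + b) * 1))) x₀ :=
        ((hphi x₀).hasDerivAt.mul_const _).mul ((hasDerivAt_id x₀).const_mul _).cexp
      rw [funext fun x => hfeP x y] at h1
      have h3 := h1.unique h2
      have h4 := hfeP x₀ y
      have h5 : (phi y * Complex.exp ((a * varphi x₀ + b) * y)) ≠ 0 :=
        mul_ne_zero hy (Complex.exp_ne_zero _)
      have h6 : phi x₀ * deriv P x₀ + phi x₀ * P x₀ * a * A * y =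
          P x₀ * deriv phi x₀ + P x₀ * phi x₀ * (a * varphi y + b) := by
        apply mul_left_cancel₀ h5
        linear_combination phi x₀ * h3 - (deriv phi x₀ + phi x₀ * (a * varphi y + b)) * h4
      have h7 : varphi y = A * y + B := by
        rw [hB]
        field_simp
        linear_combination -h6
      rw [h7, sub_self, mul_zero]
    rcases hphi.eq_zero_or_eq_zero_of_forall_mul_eq_zero
      (g := fun y => varphi y - (A * y + B)) (by fun_prop) hz with h0 | h0
    · exact absurd (h0 x₀) hx₁
    · exact fun y => sub_eq_zero.1 (h0 y)
  -- With `varphi` affine, `hfeP x₀ y` is already the desired relation; the third witness collects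
  -- the factors independent of `y`.
  refine ⟨A, B, P x₀ / phi x₀ * Complex.exp (-(b * B + a * B * x₀ + b * x₀)), b + a * B - b * A,
    mul_ne_zero (div_ne_zero hP0 hx₁) (Complex.exp_ne_zero _), rfl, haff, fun y => ?_⟩
  have h1 := hfeP x₀ y
  have h2 : Complex.exp ((a * varphi x₀ + b) * y) =
      Complex.exp (-(b * B + a * B * x₀ + b * x₀)) * Complex.exp ((b + a * B - b * A) * y) *
        Complex.exp (b * varphi y) * Complex.exp ((a * varphi y + b) * x₀) := by
    rw [← Complex.exp_add, ← Complex.exp_add, ← Complex.exp_add, haff, haff]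
    congr 1
    ring
  have h3 : Complex.exp (b * varphi y) * Complex.exp ((a * varphi y + b) * x₀) ≠ 0 :=
    mul_ne_zero (Complex.exp_ne_zero _) (Complex.exp_ne_zero _)
  rw [← haff y]
  apply mul_left_cancel₀ (mul_ne_zero hx₁ h3)
  rw [h2] at h1
  have h4 : phi x₀ * (P x₀ / phi x₀) = P x₀ := by field_simp
  have h5 : P y = psi y * (a * varphi y + b) ^ m * Complex.exp (b * varphi y) := rfl
  rw [h5] at h1
  linear_combination h1 + phi y * Complex.exp (-(b * B + a * B * x₀ + b * x₀)) *
    Complex.exp ((b + a * B - b * A) * y) * Complex.exp (b * varphi y) *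
    Complex.exp ((a * varphi y + b) * x₀) * h4

end Symbols

/-! ### Dilations -/

/-- The dilation of ratio `r` centred at `p`, with an exponential weight. -/
def weightedDilation (E p : ℂ) (f : ℂ → ℂ) (r z : ℂ) : ℂ :=
  Complex.exp ((1 - r) * E * (z - p)) * f (p + r * (z - p))

theorem weightedDilation_one (E p : ℂ) (f : ℂ → ℂ) (z : ℂ) :
    weightedDilation E p f 1 z = f z := by
  simp [weightedDilation]

/-- The integral of a weighted dilation against an element of the Fock space. -/
def dilationPairing (E p : ℂ) (u f : FockSpace) (r : ℂ) : ℂ :=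
  ∫ z : ℂ, star (u z) * weightedDilation E p f r z * (Real.exp (-‖z‖ ^ 2) : ℂ)

theorem inner_eq_dilationPairing_one (E p : ℂ) (u f : FockSpace) :
    inner ℂ u f = (1 / (Real.pi : ℂ)) * dilationPairing E p u f 1 := by
  simp only [FockSpace.inner_def, dilationPairing, weightedDilation_one]

theorem norm_weightedDilation_le (E p : ℂ) (f : FockSpace) {q : ℝ} (hq : q ≤ 1) {r : ℂ}
    (hr : ‖r‖ ≤ q) (z : ℂ) :
    ‖weightedDilation E p f r z‖ ≤ ‖f‖ * Real.exp (2 * ‖E‖ * ‖p‖ + 2 * ‖p‖ ^ 2) *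
      (Real.exp ((2 * ‖E‖ + 2 * ‖p‖) * ‖z‖) * Real.exp (q ^ 2 / 2 * ‖z‖ ^ 2)) := by
  have hq0 : 0 ≤ q := (norm_nonneg r).trans hr
  have hzp : ‖z - p‖ ≤ ‖z‖ + ‖p‖ := norm_sub_le z p
  have h1 : ((1 - r) * E * (z - p)).re ≤ 2 * ‖E‖ * (‖z‖ + ‖p‖) := by
    refine (Complex.re_le_norm _).trans ?_
    rw [norm_mul, norm_mul]
    have : ‖1 - r‖ ≤ 2 := by
      have := norm_sub_le 1 r
      rw [norm_one] at this
      linarith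
    gcongr
  have h2 : ‖p + r * (z - p)‖ ≤ 2 * ‖p‖ + q * ‖z‖ := by
    calc ‖p + r * (z - p)‖ ≤ ‖p‖ + ‖r‖ * ‖z - p‖ := by
          rw [← norm_mul]; exact norm_add_le _ _
      _ ≤ ‖p‖ + q * (‖z‖ + ‖p‖) := by gcongr
      _ ≤ 2 * ‖p‖ + q * ‖z‖ := by nlinarith [norm_nonneg p]
  have h3 : ‖p + r * (z - p)‖ ^ 2 / 2 ≤ 2 * ‖p‖ ^ 2 + 2 * ‖p‖ * ‖z‖ + q ^ 2 / 2 * ‖z‖ ^ 2 := by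
    have := pow_le_pow_left₀ (norm_nonneg _) h2 2
    nlinarith [mul_nonneg (mul_nonneg (norm_nonneg p) (norm_nonneg z)) (sub_nonneg.2 hq)]
  rw [weightedDilation, norm_mul, Complex.norm_exp]
  calc _ ≤ Real.exp (2 * ‖E‖ * (‖z‖ + ‖p‖)) *
        (‖f‖ * Real.exp (2 * ‖p‖ ^ 2 + 2 * ‖p‖ * ‖z‖ + q ^ 2 / 2 * ‖z‖ ^ 2)) := by
        gcongr
        refine (f.norm_apply_le _).trans ?_
        gcongr
    _ = _ := by
        rw [mul_left_comm, mul_assoc ‖f‖, ← Real.exp_add, ← Real.exp_add, ← Real.exp_add]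
        congr 2
        ring

theorem continuous_weightedDilation (E p : ℂ) (f : FockSpace) :
    Continuous (fun x : ℂ × ℂ => weightedDilation E p f x.2 x.1) := by
  have := f.continuous
  unfold weightedDilation
  fun_prop

theorem differentiableOn_dilationPairing (E p : ℂ) (u f : FockSpace) :
    DifferentiableOn ℂ (dilationPairing E p u f) (Metric.ball 0 1) := by
  intro r₀ hr₀
  rw [mem_ball_zero_iff] at hr₀
  refine DifferentiableAt.differentiableWithinAt ?_
  have hu := u.continuous
  have hfc := continuous_weightedDilation E p f
  have hfd := f.differentiable
  set q : ℝ := ‖r₀‖ + (1 - ‖r₀‖) / 2 with hq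
  have hq0 : 0 ≤ q := by linarith [norm_nonneg r₀]
  have hq1 : q < 1 := by linarith
  set K := ‖f‖ * Real.exp (2 * ‖E‖ * ‖p‖ + 2 * ‖p‖ ^ 2) with hK
  have h := hasDerivAt_integral_of_locally_dominated (x₀ := r₀) (r := (1 - ‖r₀‖) / 2)
    (F := fun r z => star (u z) * weightedDilation E p f r z * (Real.exp (-‖z‖ ^ 2) : ℂ))
    (bound := fun z => K * (‖u z‖ * (‖z‖ ^ 0 * Real.exp ((2 * ‖E‖ + 2 * ‖p‖) * ‖z‖) *
      Real.exp (-(1 - q ^ 2 / 2) * ‖z‖ ^ 2))))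
    (by fun_prop) (by linarith) ?_
    ((u.integrable_norm_mul 0 _ (by nlinarith)).const_mul K) ?_
  · exact h.2.differentiableAt
  · intro z
    unfold weightedDilation
    fun_prop
  · intro z r hr
    have hr' : ‖r‖ ≤ q := by
      rw [mem_ball_iff_norm] at hr
      linarith [norm_sub_norm_le r r₀]
    rw [norm_mul, norm_mul, norm_star, Complex.norm_real, Real.norm_of_nonneg (Real.exp_pos _).le]
    refine (mul_le_mul_of_nonneg_right (mul_le_mul_of_nonneg_left
      (norm_weightedDilation_le E p f hq1.le hr' z) (norm_nonneg _))
      (Real.exp_pos _).le).trans_eq ?_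
    rw [show -(1 - q ^ 2 / 2) * ‖z‖ ^ 2 = q ^ 2 / 2 * ‖z‖ ^ 2 + -‖z‖ ^ 2 by ring,
      Real.exp_add (q ^ 2 / 2 * ‖z‖ ^ 2), hK]
    ring

/-- The bound is uniform up to `r = 1` because the linear exponent from the weight and the centre,
and the Gaussian gain `(1 - r ^ 2) * ‖z - p‖ ^ 2`, both carry a factor `1 - r`; completing the
square leaves a constant. -/
theorem sq_norm_weightedDilation_mul_exp_le (E p : ℂ) (f : ℂ → ℂ) {r : ℝ}
    (hr : r ∈ Set.Icc (1 / 2) 1)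
    (z : ℂ) :
    ‖weightedDilation E p f r z‖ ^ 2 * Real.exp (-‖z‖ ^ 2) ≤ Real.exp ((‖E‖ + ‖p‖) ^ 2) *
      (‖f (p + r * (z - p))‖ ^ 2 * Real.exp (-‖p + r * (z - p)‖ ^ 2)) := by
  obtain ⟨hr0, hr1⟩ := hr
  obtain ⟨v, rfl⟩ : ∃ v, z = p + v := ⟨z - p, by ring⟩
  rw [add_sub_cancel_left, weightedDilation, add_sub_cancel_left, norm_mul, mul_pow,
    Complex.norm_exp, ← Real.exp_nat_mul]
  have h1 : ((1 - (r : ℂ)) * E * v).re = (1 - r) * (E * v).re := by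
    rw [mul_assoc, show (1 - (r : ℂ)) = ((1 - r : ℝ) : ℂ) by push_cast; ring, Complex.re_ofReal_mul]
  have h2 : ‖p + r * v‖ ^ 2 - ‖p + v‖ ^ 2 =
      (r ^ 2 - 1) * ‖v‖ ^ 2 - 2 * (1 - r) * (star p * v).re := by
    simp only [Complex.sq_norm, Complex.normSq_apply, Complex.add_re, Complex.add_im,
      Complex.mul_re, Complex.mul_im, Complex.ofReal_re, Complex.ofReal_im, RCLike.star_def,
      Complex.conj_re, Complex.conj_im]
    ring
  have h3 : (E * v).re ≤ ‖E‖ * ‖v‖ := (Complex.re_le_norm _).trans_eq (norm_mul _ _)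
  have h4 : -(star p * v).re ≤ ‖p‖ * ‖v‖ := by
    have := (neg_le_abs _).trans (Complex.abs_re_le_norm (star p * v))
    rwa [norm_mul, norm_star] at this
  have h5 : (2 : ℕ) * ((1 - r) * (E * v).re) + -‖p + v‖ ^ 2 ≤
      (‖E‖ + ‖p‖) ^ 2 + -‖p + r * v‖ ^ 2 := by
    push_cast
    have h6 : 2 * ((1 - r) * ((E * v).re - (star p * v).re)) ≤
        2 * ((1 - r) * ((‖E‖ + ‖p‖) * ‖v‖)) := by
      have : 0 ≤ 1 - r := by linarith
      gcongr
      linarith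
    have h7 : (1 - r) * (2 * ((‖E‖ + ‖p‖) * ‖v‖) - ‖v‖ ^ 2) ≤ (1 - r) * (‖E‖ + ‖p‖) ^ 2 := by
      have : 0 ≤ 1 - r := by linarith
      refine mul_le_mul_of_nonneg_left ?_ this
      nlinarith [sq_nonneg (‖E‖ + ‖p‖ - ‖v‖)]
    nlinarith [mul_nonneg (mul_nonneg (show (0 : ℝ) ≤ r by linarith)
      (show 0 ≤ 1 - r by linarith)) (sq_nonneg ‖v‖),
      mul_nonneg (show (0 : ℝ) ≤ r by linarith) (sq_nonneg (‖E‖ + ‖p‖))]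
  rw [h1]
  calc _ = ‖f (p + r * v)‖ ^ 2 *
        Real.exp ((2 : ℕ) * ((1 - r) * (E * v).re) + -‖p + v‖ ^ 2) := by
        rw [Real.exp_add]; ring
    _ ≤ ‖f (p + r * v)‖ ^ 2 * Real.exp ((‖E‖ + ‖p‖) ^ 2 + -‖p + r * v‖ ^ 2) := by gcongr
    _ = _ := by rw [Real.exp_add]; ring

theorem integrable_comp_homothety {H : ℂ → ℝ} (hH : Integrable H) (p : ℂ) {r : ℝ} (hr : r ≠ 0) :
    Integrable (fun z : ℂ => H (p + r * (z - p))) := by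
  have h := (integrable_comp_smul_iff volume (fun x => H (x + (p - r * p))) hr).2
    (hH.comp_add_right _)
  refine h.congr (.of_forall fun z => ?_)
  simp only [Complex.real_smul]
  congr 1
  ring

theorem integral_comp_homothety (H : ℂ → ℝ) (p : ℂ) (r : ℝ) :
    ∫ z : ℂ, H (p + r * (z - p)) = (r ^ 2)⁻¹ * ∫ z, H z := by
  have h := Measure.integral_comp_smul volume (fun x : ℂ => H (x + (p - r * p))) r
  rw [integral_add_right_eq_self, Complex.finrank_real_complex, abs_of_nonneg (by positivity)] at h
  rw [← smul_eq_mul, ← h]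
  refine integral_congr_ae (.of_forall fun z => ?_)
  simp only [Complex.real_smul]
  congr 1
  ring


theorem mul_mul_le_add_of_pos (x y : ℝ) {ε w : ℝ} (hε : 0 < ε) (hw : 0 ≤ w) :
    x * y * w ≤ ε * (y ^ 2 * w) + (4 * ε)⁻¹ * (x ^ 2 * w) := by
  have h3 : ε * (y ^ 2 * w) + (4 * ε)⁻¹ * (x ^ 2 * w) - x * y * w =
      w * ((2 * ε * y - x) ^ 2 / (4 * ε)) := by
    field_simp
    ring
  have h4 : 0 ≤ w * ((2 * ε * y - x) ^ 2 / (4 * ε)) := by positivity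
  linarith

/-- The available majorant moves with `r`, so truncated integrals over balls are shown to converge
uniformly instead. Young's inequality splits the tail into a small multiple of the dilated mass of
`f`, bounded uniformly in `r`, and a large multiple of the tail of `u`, which tends to zero. -/
theorem continuousOn_dilationPairing_ofReal (E p : ℂ) (u f : FockSpace) :
    ContinuousOn (fun r : ℝ => dilationPairing E p u f r) (Set.Icc (1 / 2) 1) := by
  have hu := u.continuous
  have hf := f.continuous
  set F : ℝ → ℂ → ℂ := fun r z =>
    star (u z) * weightedDilation E p f r z * (Real.exp (-‖z‖ ^ 2) : ℂ) with hF
  have hFc : Continuous (fun x : ℝ × ℂ => F x.1 x.2) := by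
    simp only [hF, weightedDilation]
    fun_prop
  set H : ℂ → ℝ := fun z => ‖f z‖ ^ 2 * Real.exp (-‖z‖ ^ 2) with hH
  set U : ℂ → ℝ := fun z => ‖u z‖ ^ 2 * Real.exp (-‖z‖ ^ 2) with hU
  have hHi : Integrable H := f.integrable
  have hUi : Integrable U := u.integrable
  set M := Real.exp ((‖E‖ + ‖p‖) ^ 2) with hM
  have hyoung : ∀ ε : ℝ, 0 < ε → ∀ r ∈ Set.Icc (1 / 2 : ℝ) 1, ∀ z,
      ‖F r z‖ ≤ ε * (M * H (p + r * (z - p))) + (4 * ε)⁻¹ * U z := by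
    intro ε hε r hr z
    have h1 := sq_norm_weightedDilation_mul_exp_le E p f hr z
    have h2 := mul_le_mul_of_nonneg_left h1 hε.le
    refine le_trans ?_ (add_le_add_left h2 _)
    simp only [hF, hU]
    rw [norm_mul, norm_mul, norm_star, Complex.norm_real, Real.norm_of_nonneg (Real.exp_pos _).le]
    exact mul_mul_le_add_of_pos _ _ hε (Real.exp_pos _).le
  have hdom : ∀ ε : ℝ, 0 < ε → ∀ r ∈ Set.Icc (1 / 2 : ℝ) 1,
      Integrable (fun z : ℂ => ε * (M * H (p + r * (z - p))) + (4 * ε)⁻¹ * U z) := by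
    intro ε hε r hr
    have hr0 : r ≠ 0 := by linarith [hr.1]
    exact (((integrable_comp_homothety hHi p hr0).const_mul M).const_mul ε).add (hUi.const_mul _)
  have hFi : ∀ r ∈ Set.Icc (1 / 2 : ℝ) 1, Integrable (F r) := by
    intro r hr
    refine (hdom 1 one_pos r hr).mono' (Continuous.aestronglyMeasurable ?_)
      (.of_forall (hyoung 1 one_pos r hr))
    exact hFc.comp (by fun_prop : Continuous fun z : ℂ => (r, z))
  have hH0 : ∀ z, 0 ≤ H z := fun z => by positivity
  have hHint : 0 ≤ ∫ z, H z := integral_nonneg hH0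
  have hcont : ∀ n : ℕ, Continuous (fun r : ℝ => ∫ z in Metric.closedBall (0 : ℂ) n, F r z) :=
    fun n => continuous_parametric_integral_of_continuous hFc (isCompact_closedBall _ _)
  have htail : Filter.Tendsto (fun n : ℕ => ∫ z in (Metric.closedBall (0 : ℂ) n)ᶜ, U z)
      Filter.atTop (nhds 0) := by
    have h1 := (aecover_closedBall (μ := (volume : Measure ℂ)) (x := 0)
      (tendsto_natCast_atTop_atTop (R := ℝ))).integral_tendsto_of_countably_generated hUi
    have h2 := h1.const_sub (∫ z, U z)
    rw [sub_self] at h2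
    refine h2.congr fun n => ?_
    rw [← integral_add_compl (Metric.isClosed_closedBall (x := (0 : ℂ)) (ε := n)).measurableSet hUi]
    ring
  have hunif : TendstoUniformlyOn
      (fun (n : ℕ) (r : ℝ) => ∫ z in Metric.closedBall (0 : ℂ) n, F r z)
      (fun r : ℝ => dilationPairing E p u f r) Filter.atTop (Set.Icc (1 / 2) 1) := by
    rw [Metric.tendstoUniformlyOn_iff]
    intro δ hδ
    -- The factor `4` bounds the Jacobian `(r ^ 2)⁻¹` for `r ≥ 1 / 2`.
    set L := M * (4 * ∫ z, H z) with hL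
    have hL0 : 0 ≤ L := by positivity
    set ε := δ / (2 * (L + 1)) with hε
    have hε0 : 0 < ε := by positivity
    have hεL : ε * L < δ / 2 := by
      have h1 : ε * (L + 1) = δ / 2 := by
        rw [hε]
        field_simp
      linarith
    filter_upwards [htail.eventually_lt_const (show 0 < 4 * ε * (δ / 2) by positivity)]
      with n hn r hr
    have hr0 : r ≠ 0 := by linarith [hr.1]
    have h1 : dilationPairing E p u f r = ∫ z, F r z := rfl
    rw [dist_eq_norm, h1, ← integral_add_compl
      (Metric.isClosed_closedBall (x := (0 : ℂ)) (ε := n)).measurableSet (hFi r hr),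
      add_sub_cancel_left]
    have hHr := integrable_comp_homothety hHi p hr0
    calc ‖∫ z in (Metric.closedBall (0 : ℂ) n)ᶜ, F r z‖
        ≤ ∫ z in (Metric.closedBall (0 : ℂ) n)ᶜ,
            (ε * (M * H (p + r * (z - p))) + (4 * ε)⁻¹ * U z) :=
          norm_integral_le_of_norm_le (hdom ε hε0 r hr).integrableOn
            (.of_forall (hyoung ε hε0 r hr))
      _ = ε * (M * ∫ z in (Metric.closedBall (0 : ℂ) n)ᶜ, H (p + r * (z - p))) +
            (4 * ε)⁻¹ * ∫ z in (Metric.closedBall (0 : ℂ) n)ᶜ, U z := by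
          rw [integral_add (((hHr.const_mul M).const_mul ε).integrableOn)
            ((hUi.const_mul _).integrableOn), integral_const_mul, integral_const_mul,
            integral_const_mul]
      _ ≤ ε * L + (4 * ε)⁻¹ * ∫ z in (Metric.closedBall (0 : ℂ) n)ᶜ, U z := by
          have h2 : ∫ z in (Metric.closedBall (0 : ℂ) n)ᶜ, H (p + r * (z - p)) ≤ 4 * ∫ z, H z := by
            refine (setIntegral_le_integral hHr (.of_forall fun z => hH0 _)).trans ?_
            rw [integral_comp_homothety]
            gcongr
            rw [inv_le_comm₀ (by positivity) (by norm_num)]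
            nlinarith [hr.1]
          gcongr
          exact mul_le_mul_of_nonneg_left h2 (Real.exp_pos _).le
      _ < δ / 2 + δ / 2 := by
          refine add_lt_add hεL ?_
          rwa [inv_mul_lt_iff₀ (by positivity)]
      _ = δ := add_halves δ
  exact hunif.continuousOn (.of_forall fun n => (hcont n).continuousOn)

/-- A weak form of the convergence of the dilations to the identity, together with the
analyticity in the ratio, extends identities from small ratios to ratio one. -/
theorem inner_eq_of_dilationPairing_eventuallyEq {E p : ℂ} {u f v g : FockSpace}
    (h : ∀ᶠ r in nhds (0 : ℂ), dilationPairing E p u f r = dilationPairing E p v g r) :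
    inner ℂ u f = inner ℂ v g := by
  have h1 : Set.EqOn (dilationPairing E p u f) (dilationPairing E p v g) (Metric.ball 0 1) :=
    ((differentiableOn_dilationPairing E p u f).analyticOnNhd
      Metric.isOpen_ball).eqOn_of_preconnected_of_eventuallyEq
      ((differentiableOn_dilationPairing E p v g).analyticOnNhd Metric.isOpen_ball)
      (convex_ball 0 1).isPreconnected (Metric.mem_ball_self one_pos) h
  have h2 : Set.EqOn (fun r : ℝ => dilationPairing E p u f r)
      (fun r : ℝ => dilationPairing E p v g r) (Set.Ico (1 / 2) 1) := by
    intro r hr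
    refine h1 ?_
    rw [mem_ball_zero_iff, Complex.norm_real, Real.norm_of_nonneg (by linarith [hr.1])]
    exact hr.2
  have h3 := h2.of_subset_closure (continuousOn_dilationPairing_ofReal E p u f)
    (continuousOn_dilationPairing_ofReal E p v g) Set.Ico_subset_Icc_self
    (by rw [closure_Ico (by norm_num)])
  have h4 := h3 (Set.right_mem_Icc.2 (by norm_num : (1 / 2 : ℝ) ≤ 1))
  simp only [Complex.ofReal_one] at h4
  rw [inner_eq_dilationPairing_one E p, inner_eq_dilationPairing_one E p, h4]

/-! ### Symmetry of the maximal operator -/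

theorem pow_norm_affine_le (a b z : ℂ) (m : ℕ) :
    ‖a * z + b‖ ^ m ≤ m.factorial * Real.exp ‖b‖ * Real.exp (‖a‖ * ‖z‖) := by
  have h1 : ‖a * z + b‖ ^ m ≤ m.factorial * Real.exp ‖a * z + b‖ := by
    have := Real.pow_div_factorial_le_exp _ (norm_nonneg (a * z + b)) m
    rwa [div_le_iff₀' (by positivity)] at this
  refine h1.trans ?_
  rw [mul_assoc, ← Real.exp_add]
  gcongr
  refine (norm_add_le _ _).trans_eq ?_
  rw [norm_mul, add_comm]

/-- The kernel `(az + b)^m (aw + b)^m exp(sz + sw + lzw)`. -/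
def symmKernel (a b s l : ℂ) (m : ℕ) (z w : ℂ) : ℂ :=
  (a * z + b) ^ m * (a * w + b) ^ m * Complex.exp (s * z + s * w + l * (z * w))

theorem symmKernel_comm (a b s l : ℂ) (m : ℕ) (z w : ℂ) :
    symmKernel a b s l m z w = symmKernel a b s l m w z := by
  simp only [symmKernel]
  ring_nf

/-- For `‖l‖ ≤ 1 / 2` the mixed term is at most `(‖z‖ ^ 2 + ‖w‖ ^ 2) / 4`, which leaves Gaussian
decay of rate `3 / 4` in each variable, above the threshold `1 / 2`. -/
theorem norm_symmKernel_le (a b s : ℂ) {l : ℂ} (hl : ‖l‖ ≤ 1 / 2) (m : ℕ) (z w : ℂ) :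
    ‖symmKernel a b s l m z w‖ ≤ (m.factorial * Real.exp ‖b‖) ^ 2 *
      ((Real.exp ((‖a‖ + ‖s‖) * ‖z‖) * Real.exp (1 / 4 * ‖z‖ ^ 2)) *
      (Real.exp ((‖a‖ + ‖s‖) * ‖w‖) * Real.exp (1 / 4 * ‖w‖ ^ 2))) := by
  rw [symmKernel, norm_mul, norm_mul, norm_pow, norm_pow, Complex.norm_exp]
  have h1 : (s * z + s * w + l * (z * w)).re ≤
      ‖s‖ * ‖z‖ + ‖s‖ * ‖w‖ + (1 / 4 * ‖z‖ ^ 2 + 1 / 4 * ‖w‖ ^ 2) := by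
    refine (Complex.re_le_norm _).trans ?_
    have h2 := norm_add₃_le (a := s * z) (b := s * w) (c := l * (z * w))
    simp only [norm_mul] at h2
    have h3 : ‖l‖ * (‖z‖ * ‖w‖) ≤ 1 / 2 * (‖z‖ * ‖w‖) := by gcongr
    nlinarith [sq_nonneg (‖z‖ - ‖w‖)]
  calc _ ≤ (m.factorial * Real.exp ‖b‖ * Real.exp (‖a‖ * ‖z‖)) *
        (m.factorial * Real.exp ‖b‖ * Real.exp (‖a‖ * ‖w‖)) *
        Real.exp (‖s‖ * ‖z‖ + ‖s‖ * ‖w‖ + (1 / 4 * ‖z‖ ^ 2 + 1 / 4 * ‖w‖ ^ 2)) := by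
        gcongr
        · exact pow_norm_affine_le a b z m
        · exact pow_norm_affine_le a b w m
    _ = _ := by
        rw [add_mul, add_mul, Real.exp_add, Real.exp_add, Real.exp_add,
          Real.exp_add (‖a‖ * ‖z‖), Real.exp_add (‖a‖ * ‖w‖)]
        ring

theorem integral_symmKernel_comm (a b s : ℂ) {l : ℂ} (hl : ‖l‖ ≤ 1 / 2) (m : ℕ)
    (u v : FockSpace) :
    ∫ z : ℂ, star (u z) * (∫ w : ℂ, star (v w) * symmKernel a b s l m z w *
        (Real.exp (-‖w‖ ^ 2) : ℂ)) * (Real.exp (-‖z‖ ^ 2) : ℂ) =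
      ∫ z : ℂ, star (v z) * (∫ w : ℂ, star (u w) * symmKernel a b s l m z w *
        (Real.exp (-‖w‖ ^ 2) : ℂ)) * (Real.exp (-‖z‖ ^ 2) : ℂ) := by
  have hu := u.continuous
  have hv := v.continuous
  set T : ℂ → ℂ → ℂ := fun z w => star (u z) * (Real.exp (-‖z‖ ^ 2) : ℂ) *
    (star (v w) * symmKernel a b s l m z w * (Real.exp (-‖w‖ ^ 2) : ℂ)) with hT
  set k := ‖a‖ + ‖s‖ with hk
  have hint : Integrable (Function.uncurry T) (volume.prod volume) := by
    refine ((((u.integrable_norm_mul 0 k (ε := 3 / 4) (by norm_num)).mul_prod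
      (v.integrable_norm_mul 0 k (ε := 3 / 4) (by norm_num)))).const_mul
      ((m.factorial * Real.exp ‖b‖) ^ 2)).mono' ?_ (.of_forall fun x => ?_)
    · refine Continuous.aestronglyMeasurable ?_
      simp only [hT, symmKernel, Function.uncurry_def]
      fun_prop
    · obtain ⟨z, w⟩ := x
      simp only [hT, Function.uncurry_apply_pair, norm_mul, norm_star, Complex.norm_real,
        Real.norm_of_nonneg (Real.exp_pos _).le, pow_zero, one_mul]
      have h1 := norm_symmKernel_le a b s hl m z w
      have h2 : ∀ x : ℂ, Real.exp (-(3 / 4) * ‖x‖ ^ 2) =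
          Real.exp (1 / 4 * ‖x‖ ^ 2) * Real.exp (-‖x‖ ^ 2) := fun x => by
        rw [← Real.exp_add]
        ring_nf
      rw [h2, h2]
      calc _ = ‖symmKernel a b s l m z w‖ *
            (‖u z‖ * Real.exp (-‖z‖ ^ 2) * (‖v w‖ * Real.exp (-‖w‖ ^ 2))) := by ring
        _ ≤ _ := mul_le_mul_of_nonneg_right h1 (by positivity)
        _ = _ := by rw [hk]; ring
  have h1 := integral_integral_swap hint
  refine Eq.trans ?_ (h1.trans ?_)
  · refine integral_congr_ae (.of_forall fun z => ?_)
    simp only [hT]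
    rw [integral_const_mul]
    ring
  · refine integral_congr_ae (.of_forall fun w => ?_)
    simp only [hT]
    rw [mul_right_comm, ← integral_const_mul]
    refine integral_congr_ae (.of_forall fun z => ?_)
    simp only [symmKernel_comm a b s l m z w]
    ring

section Symmetric

variable {m : ℕ} {a b c : ℂ} {psi varphi phi : ℂ → ℂ}

/-- For symbols of the explicit form the weighted dilations of `f`, for `(f, g)` in the graph,
are integral transforms of `g` with a symmetric kernel. -/
theorem weightedDilation_eq_integral (h : IsConjugationParam a b c) {A B C D : ℂ} (hA : A ≠ 0)
    (hC : C ≠ 0) (hD : D = b + a * B - b * A) {f g : FockSpace}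
    (hfg : ∀ y, C * Complex.exp (D * y) * f (A * y + B) =
      (a * (A * y + B) + b) ^ m * iteratedDeriv m (g : ℂ → ℂ) y) (r z : ℂ) :
    weightedDilation (-D / A) (star b) f r z =
      1 / (Real.pi : ℂ) * (C⁻¹ * r ^ m * c *
        Complex.exp (D * (B / A) + b * (star b / A - B / A - r * star b / A))) *
      ∫ w : ℂ, star (weightedConjugation h g w) *
        symmKernel a b (b - b / A - a * B / A + b * r / A) (a * r / A) m z w *
        (Real.exp (-‖w‖ ^ 2) : ℂ) := by
  have hab := h.mul_star_right
  set x := star b + r * (z - star b) with hx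
  set y := (x - B) / A with hy
  have hxy : A * y + B = x := by
    rw [hy]
    field_simp
    ring
  -- The centre `star b` is the zero of `a * x + b`, so dilating about it only scales this factor.
  have hax : a * x + b = r * (a * z + b) := by
    rw [hx]
    linear_combination (1 - r) * hab
  have h1 := hfg y
  rw [hxy, hax, mul_pow, ← inner_weightedConjugation_conjKernel h m y g, FockSpace.inner_def] at h1
  have h2 : f x = C⁻¹ * Complex.exp (-(D * y)) * (r ^ m * (a * z + b) ^ m *
      (1 / (Real.pi : ℂ) * ∫ w : ℂ, star (weightedConjugation h g w) * conjKernel h m y w *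
        (Real.exp (-‖w‖ ^ 2) : ℂ))) := by
    rw [← h1, Complex.exp_neg]
    have := Complex.exp_ne_zero (D * y)
    field_simp
  rw [weightedDilation, ← hx, h2, ← integral_const_mul, ← integral_const_mul, ← integral_const_mul,
    ← integral_const_mul, ← integral_const_mul]
  refine integral_congr_ae (.of_forall fun w => ?_)
  simp only [conjKernel_apply, symmKernel]
  -- The weight with `E = -D / A` turns the coefficient `-D * r / A` of `z` into `-D / A`; by the
  -- formula for `D`, the linear coefficients of `z` and `w` then agree.
  have hexp : Complex.exp ((1 - r) * (-D / A) * (z - star b)) * Complex.exp (-(D * y)) *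
      (Complex.exp (b * w) * Complex.exp ((a * w + b) * y)) =
      Complex.exp (D * (B / A) + b * (star b / A - B / A - r * star b / A)) *
      Complex.exp ((b - b / A - a * B / A + b * r / A) * z +
        (b - b / A - a * B / A + b * r / A) * w + a * r / A * (z * w)) := by
    rw [← Complex.exp_add, ← Complex.exp_add, ← Complex.exp_add, ← Complex.exp_add]
    congr 1
    rw [hy, hx, hD]
    field_simp
    linear_combination (1 - r) * w * hab
  linear_combination (C⁻¹ * r ^ m * (a * z + b) ^ m * (1 / (Real.pi : ℂ)) *
    star (weightedConjugation h g w) * c * (a * w + b) ^ m * (Real.exp (-‖w‖ ^ 2) : ℂ)) * hexp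

theorem inner_comm_of_mem_maximalOperator (h : IsConjugationParam a b c)
    (hpsi : ∀ z, psi z ≠ 0) (hconst : 1 ≤ m → ∃ z w, varphi z ≠ varphi w)
    (he : HasExplicitForm m a b psi varphi phi) {p q : FockSpace × FockSpace}
    (hp : p ∈ maximalOperator m psi varphi phi) (hq : q ∈ maximalOperator m psi varphi phi) :
    inner ℂ (weightedConjugation h q.2) p.1 = inner ℂ (weightedConjugation h p.2) q.1 := by
  obtain ⟨A, B, C, D, hC, hD, hv, hf⟩ := he
  have hgraph : ∀ p ∈ maximalOperator m psi varphi phi, ∀ y,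
      C * Complex.exp (D * y) * p.1 (A * y + B) =
        (a * (A * y + B) + b) ^ m * iteratedDeriv m (p.2 : ℂ → ℂ) y := by
    intro p hp y
    have h1 := hp y
    rw [hv] at h1
    apply mul_left_cancel₀ (hpsi y)
    linear_combination C * Complex.exp (D * y) * h1 + iteratedDeriv m (p.2 : ℂ → ℂ) y * hf y
  by_cases hA : A = 0
  -- Here `varphi` is constant, so `m = 0` and `g` is a multiple of one kernel; the symmetry is that
  -- of a rank one form.
  · have hm : m = 0 := by
      by_contra hm
      obtain ⟨z, w, hzw⟩ := hconst (Nat.one_le_iff_ne_zero.2 hm)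
      exact hzw (by rw [hv, hv, hA, zero_mul, zero_mul])
    subst hm
    subst hA
    have hrank : ∀ p ∈ maximalOperator 0 psi varphi phi,
        p.2 = (C * p.1 B * c⁻¹ * Complex.exp (-(b * B))) • conjKernel h 0 B := by
      intro p hp
      ext y
      have h1 := hgraph p hp y
      rw [pow_zero, one_mul, iteratedDeriv_zero, zero_mul, zero_add] at h1
      rw [← h1, FockSpace.smul_apply, conjKernel_apply, pow_zero, one_mul]
      have hc := h.const_ne_zero
      have hexp : Complex.exp (D * y) = Complex.exp (-(b * B)) * (Complex.exp (b * y) *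
          Complex.exp ((a * y + b) * B)) := by
        rw [← Complex.exp_add, ← Complex.exp_add, hD]
        congr 1
        ring
      rw [hexp]
      field_simp
    rw [inner_weightedConjugation_comm h q.2, inner_weightedConjugation_comm h p.2, hrank p hp,
      hrank q hq, inner_smul_right, inner_smul_right, inner_weightedConjugation_conjKernel,
      inner_weightedConjugation_conjKernel, iteratedDeriv_zero, iteratedDeriv_zero]
    ring
  · refine inner_eq_of_dilationPairing_eventuallyEq (E := -D / A) (p := star b) ?_
    have hsmall : ∀ᶠ r in nhds (0 : ℂ), ‖a * r / A‖ < 1 / 2 := by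
      have hcont : Continuous fun r : ℂ => ‖a * r / A‖ := by fun_prop
      exact hcont.continuousAt.eventually_lt_const (by simp)
    filter_upwards [hsmall] with r hr
    have hmain : ∀ (κ : ℂ) (u v : FockSpace),
        ∫ z : ℂ, star (u z) * (κ * ∫ w : ℂ, star (v w) *
          symmKernel a b (b - b / A - a * B / A + b * r / A) (a * r / A) m z w *
          (Real.exp (-‖w‖ ^ 2) : ℂ)) * (Real.exp (-‖z‖ ^ 2) : ℂ) =
        κ * ∫ z : ℂ, star (u z) * (∫ w : ℂ, star (v w) *
          symmKernel a b (b - b / A - a * B / A + b * r / A) (a * r / A) m z w *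
          (Real.exp (-‖w‖ ^ 2) : ℂ)) * (Real.exp (-‖z‖ ^ 2) : ℂ) := by
      intro κ u v
      rw [← integral_const_mul]
      refine integral_congr_ae (.of_forall fun z => ?_)
      ring
    simp only [dilationPairing]
    -- The scalar in front of the transform depends on `r` but not on the pair, so it is common to
    -- both sides.
    rw [funext (weightedDilation_eq_integral h hA hC hD (hgraph p hp) r),
      funext (weightedDilation_eq_integral h hA hC hD (hgraph q hq) r), hmain, hmain,
      integral_symmKernel_comm _ _ _ hr.le]

end Symmetric

end

/-! ### The equivalence -/

theorem mainTheorem2 (m : ℕ) (a b c : ℂ) (habc : IsConjugationParam a b c)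
    (psi varphi phi : ℂ → ℂ) (hpsi : Differentiable ℂ psi) (hvarphi : Differentiable ℂ varphi)
    (hphi : Differentiable ℂ phi) (hphi0 : ∃ z, phi z ≠ 0) (hpsi0 : ∀ z, psi z ≠ 0)
    (hconst : 1 ≤ m → ∃ z w, varphi z ≠ varphi w) :
    List.TFAE [
      IsSelfadjointWrt (weightedConjugation habc) (maximalOperator m psi varphi phi),
      adjointGraph (weightedConjugation habc) (maximalOperator m psi varphi phi) ⊆
        (maximalOperator m psi varphi phi : Set (FockSpace × FockSpace)),
      ∃ psi' phi' : ℂ → ℂ, Differentiable ℂ psi' ∧ Differentiable ℂ phi' ∧ (∀ z, psi' z ≠ 0) ∧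
        EquivalentSymbols psi phi psi' phi' ∧ HasExplicitForm m a b psi' varphi phi'] := by
  tfae_have 1 → 2 := fun h => h.subset
  tfae_have 2 → 3 := fun h => ⟨psi, phi, hpsi, hphi, hpsi0, fun _ => rfl,
    hasExplicitForm_of_kernelPair_mem habc hpsi hvarphi hphi hphi0 hpsi0 hconst
      fun y => h (kernelPair_mem_adjointGraph habc m psi varphi phi y)⟩
  tfae_have 3 → 1 := by
    rintro ⟨psi', phi', -, -, hpsi', heq, hform⟩
    have he := hform.of_equivalentSymbols hpsi0 hpsi' heq
    refine Set.Subset.antisymm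
      (adjointGraph_subset_of_kernelPair_mem habc (kernelPair_mem_of_hasExplicitForm habc he)) ?_
    intro p hp q hq
    rw [inner_weightedConjugation_comm habc p.1]
    exact inner_comm_of_mem_maximalOperator habc hpsi0 hconst he hp hq
  tfae_finish
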